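/- Let $\rho$ be a density operator (positive semidefinite, $\operatorname{tr}\rho=1$) and $\sigma$ a positive semidefinite operator, not necessarily normalized, on a finite-dimensional complex Hilbert space. Write $\log=\log_2$; logarithms and negative powers of positive semidefinite operators are taken on their supports. For $\alpha>1$, if $\operatorname{supp}\rho\subseteq\operatorname{supp}\sigma$, let \[ D(\rho\|\sigma)=\operatorname{tr}[\rho(\log\rho-\log\sigma)],\qquad V(\rho\|\sigma)=\operatorname{tr}\big[\rho\,(\log\rho-\log\sigma-D(\rho\|\sigma)\,\mathrm{id})^2\big], \] \[ D_\alpha(\rho\|\sigma)=\frac1{\alpha-1}\log\operatorname{tr}\Big[\big(\sigma^{-\frac{\alpha-1}{2\alpha}}\rho\,\sigma^{-\frac{\alpha-1}{2\alpha}}\big)^{\alpha}\Big],\qquad D'_\alpha(\rho\|\sigma)=\frac1{\alpha-1}\log\operatorname{tr}\big[\rho^\alpha\sigma^{1-\alpha}\big] \] (relative entropy, divergence variance, sandwiched and Petz Rényi divergences), and let $D=D_\alpha=D'_\alpha=+\infty$ if $\operatorname{supp}\rho\not\subseteq\operatorname{supp}\sigma$. Then for all $\alpha>1$ and $\mu\in(0,1)$,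 \[ D_\alpha(\rho\|\sigma)\le D'_\alpha(\rho\|\sigma)\le D(\rho\|\sigma)+\frac{(\alpha-1)\ln 2}{2}V(\rho\|\sigma)+(\alpha-1)^2K_{\rho,\sigma}(\alpha,\mu), \] where \[ K_{\rho,\sigma}(\alpha,\mu)=\frac1{6\mu^3\ln2}\,2^{(\alpha-1)(D'_\alpha(\rho\|\sigma)-D(\rho\|\sigma))}\,\ln^3\!\Big(2^{(\alpha+\mu-1)(D'_{\alpha+\mu}(\rho\|\sigma)-D(\rho\|\sigma))}+e^2\Big). \] If $\operatorname{supp}\rho\not\subseteq\operatorname{supp}\sigma$, then $D(\rho\|\sigma)=+\infty$ and the right-hand side is read as $+\infty$. -/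

import Mathlib

open scoped ComplexOrder

noncomputable section

/- Operators on a finite-dimensional complex Hilbert space are matrices `Matrix n n ℂ`.
`cfc f A` applies `f` to the eigenvalues of a Hermitian matrix `A`; for matrices the spectrum is
finite, so no continuity of `f` is needed. -/

/-- The support of a Hermitian operator: its range, that is, the orthogonal complement of its
kernel. -/
def opSupport {n : Type*} [Fintype n] (A : Matrix n n ℂ) : Submodule ℂ (n → ℂ) :=
  LinearMap.range A.mulVecLin

/-- The binary logarithm of a positive semidefinite operator, taken on its support
(`Real.logb 2 0 = 0`). -/
def opLog {n : Type*} [Fintype n] [DecidableEq n] (A : Matrix n n ℂ) : Matrix n n ℂ :=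
  cfc (Real.logb 2) A

/-- The power `A ^ s`, `s ≠ 0`, of a positive semidefinite operator; for `s < 0` it is taken on
the support of `A` (`(0 : ℝ) ^ s = 0` for `s ≠ 0`). -/
def opPow {n : Type*} [Fintype n] [DecidableEq n] (A : Matrix n n ℂ) (s : ℝ) : Matrix n n ℂ :=
  cfc (fun x : ℝ => x ^ s) A

/-- The trace as a real number; it is used below only for operators whose trace is real. -/
def reTrace {n : Type*} [Fintype n] (A : Matrix n n ℂ) : ℝ :=
  (Matrix.trace A).re

open Classical in
/-- The relative entropy `D(ρ‖σ)`, in bits. -/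
def relEntropy {n : Type*} [Fintype n] [DecidableEq n] (ρ σ : Matrix n n ℂ) : EReal :=
  if opSupport ρ ≤ opSupport σ then
    ((1 / reTrace ρ * reTrace (ρ * (opLog ρ - opLog σ)) : ℝ) : EReal)
  else ⊤

open Classical in
/-- The sandwiched Rényi divergence `D_α(ρ‖σ)` of order `α > 1`:
`1/(α-1) log tr[(σ^{-α'/2} ρ σ^{-α'/2})^α]` with `α' = (α-1)/α`. -/
def sandwichedDiv {n : Type*} [Fintype n] [DecidableEq n] (α : ℝ) (ρ σ : Matrix n n ℂ) : EReal :=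
  if opSupport ρ ≤ opSupport σ then
    ((1 / (α - 1) * Real.logb 2 (reTrace (opPow
      (opPow σ (-((α - 1) / α) / 2) * ρ * opPow σ (-((α - 1) / α) / 2)) α)) : ℝ) : EReal)
  else ⊤

open Classical in
/-- The Petz Rényi divergence `D'_α(ρ‖σ)` of order `α > 1`. -/
def petzDiv {n : Type*} [Fintype n] [DecidableEq n] (α : ℝ) (ρ σ : Matrix n n ℂ) : EReal :=
  if opSupport ρ ≤ opSupport σ then
    ((1 / (α - 1) * Real.logb 2 (reTrace (opPow ρ α * opPow σ (1 - α))) : ℝ) : EReal)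
  else ⊤

/-- The quantum divergence variance `V(ρ‖σ)`, meaningful when `D(ρ‖σ)` is finite. -/
def divVariance {n : Type*} [Fintype n] [DecidableEq n] (ρ σ : Matrix n n ℂ) : ℝ :=
  1 / reTrace ρ * reTrace
    (ρ * (opLog ρ - opLog σ - ((relEntropy ρ σ).toReal : ℂ) • (1 : Matrix n n ℂ)) ^ 2)

/-- The remainder coefficient `K_{ρ,σ}(α,μ)`, meaningful when `D(ρ‖σ)` is finite, in which case
both Petz divergences are finite as well. -/
def remainderK {n : Type*} [Fintype n] [DecidableEq n] (ρ σ : Matrix n n ℂ) (α μ : ℝ) : ℝ :=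
  1 / (6 * μ ^ 3 * Real.log 2) *
    (2 : ℝ) ^ ((α - 1) * ((petzDiv α ρ σ).toReal - (relEntropy ρ σ).toReal)) *
    Real.log ((2 : ℝ) ^ ((α + μ - 1) *
      ((petzDiv (α + μ) ρ σ).toReal - (relEntropy ρ σ).toReal)) + Real.exp 2) ^ 3

end

/-! The two inequalities have independent proofs.

The first is the Araki–Lieb–Thirring inequality `reTrace_opPow_sandwich_le`. With `M = B ^
(-(p-1)/(2p)) * A * B ^ (-(p-1)/(2p))`, put `F z = tr (M ^ (p - pz) * B ^ ((1-p)z/2) * A ^ (pz) * B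
^ ((1-p)z/2))`. On `re z = 0` and `re z = 1`, imaginary powers are contractions, so Cauchy–Schwarz
bounds `|F|` by `m = tr M ^ p` and `q = tr (A ^ p * B ^ (1-p))` respectively. As `F (1/p) = m`, the
three lines theorem gives `m ≤ m ^ (1 - 1/p) * q ^ (1/p)`, that is, `m ≤ q`.

The second is classical. Give the pair `(i, j)` of eigenvectors `eᵢ` of `ρ` and `fⱼ` of `σ` the
probability `λᵢ |⟨eᵢ, fⱼ⟩|²`, and let `X = ln λᵢ - ln κⱼ`, where `λᵢ`, `κⱼ` are the eigenvalues. Up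
to factors `ln 2`, `D` is the mean of `X`, `V` its variance, and `(α-1) D'_α` its cumulant
generating function at `α - 1`. The claim becomes a second-order Taylor bound, `log_sum_mul_exp_le`;
its remainder is controlled by Jensen's inequality for `log ^ 3`, which is concave on `[e², ∞)`.
This is the origin of the `e²` in `K`. -/

namespace Matrix

/-! ### Spectral calculus and eigenvector overlaps -/

variable {n : Type*} [Fintype n]

/-- The functional calculus of a Hermitian matrix for complex-valued functions of the
eigenvalues. -/
noncomputable def IsHermitian.complexCfc [DecidableEq n] {A : Matrix n n ℂ} (hA : A.IsHermitian) (f : ℝ → ℂ) :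
    Matrix n n ℂ :=
  hA.eigenvectorUnitary * diagonal (fun i => f (hA.eigenvalues i)) *
    star (hA.eigenvectorUnitary : Matrix n n ℂ)

namespace IsHermitian

variable [DecidableEq n] {A B : Matrix n n ℂ} (hA : A.IsHermitian) (hB : B.IsHermitian)

lemma cfc_eq_complexCfc (f : ℝ → ℝ) : cfc f A = hA.complexCfc (fun x => (f x : ℂ)) := by
  rw [hA.cfc_eq, IsHermitian.cfc, Unitary.conjStarAlgAut_apply]
  rfl

lemma complexCfc_congr {f g : ℝ → ℂ} (h : ∀ i, f (hA.eigenvalues i) = g (hA.eigenvalues i)) :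
    hA.complexCfc f = hA.complexCfc g := by
  simp only [complexCfc, h]

lemma complexCfc_id : hA.complexCfc (fun x => (x : ℂ)) = A := by
  conv_rhs => rw [hA.spectral_theorem, Unitary.conjStarAlgAut_apply]
  rfl

lemma complexCfc_one : hA.complexCfc (fun _ => 1) = 1 := by
  simp [complexCfc]

lemma complexCfc_mul (f g : ℝ → ℂ) :
    hA.complexCfc f * hA.complexCfc g = hA.complexCfc (fun x => f x * g x) := by
  have h : star (hA.eigenvectorUnitary : Matrix n n ℂ) * hA.eigenvectorUnitary = 1 :=
    Unitary.coe_star_mul_self _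
  simp only [complexCfc]
  calc _ = (hA.eigenvectorUnitary : Matrix n n ℂ) * diagonal (fun i => f (hA.eigenvalues i)) *
        (star (hA.eigenvectorUnitary : Matrix n n ℂ) * hA.eigenvectorUnitary) *
        diagonal (fun i => g (hA.eigenvalues i)) *
        star (hA.eigenvectorUnitary : Matrix n n ℂ) := by simp only [Matrix.mul_assoc]
    _ = _ := by
      rw [h, Matrix.mul_one, Matrix.mul_assoc (hA.eigenvectorUnitary : Matrix n n ℂ),
        diagonal_mul_diagonal]

lemma complexCfc_sub (f g : ℝ → ℂ) :
    hA.complexCfc f - hA.complexCfc g = hA.complexCfc (fun x => f x - g x) := by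
  simp only [complexCfc, ← Matrix.sub_mul, ← Matrix.mul_sub, diagonal_sub]

lemma complexCfc_smul (c : ℂ) (f : ℝ → ℂ) :
    c • hA.complexCfc f = hA.complexCfc (fun x => c * f x) := by
  have : diagonal (fun i => c * f (hA.eigenvalues i)) =
    c • diagonal (fun i => f (hA.eigenvalues i)) := by
    rw [← diagonal_smul]; rfl
  simp only [complexCfc, this, Matrix.mul_smul, Matrix.smul_mul]

lemma conjTranspose_complexCfc (f : ℝ → ℂ) :
    (hA.complexCfc f)ᴴ = hA.complexCfc (fun x => star (f x)) := by
  simp only [complexCfc, conjTranspose_mul, diagonal_conjTranspose, star_eq_conjTranspose,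
    conjTranspose_conjTranspose, Matrix.mul_assoc]
  rfl

/-- The squared overlaps `|⟨eᵢ, fⱼ⟩|²` of the eigenvectors of two Hermitian matrices. -/
noncomputable def overlap (i j : n) : ℝ :=
  ‖(star (hA.eigenvectorUnitary : Matrix n n ℂ) * (hB.eigenvectorUnitary : Matrix n n ℂ)) i j‖ ^ 2

lemma overlap_nonneg (i j : n) : 0 ≤ hA.overlap hB i j := sq_nonneg _

lemma sum_overlap (i : n) : ∑ j, hA.overlap hB i j = 1 := by
  set U := (hA.eigenvectorUnitary : Matrix n n ℂ)
  set W := (hB.eigenvectorUnitary : Matrix n n ℂ)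
  have hU : star U * U = 1 := Unitary.coe_star_mul_self _
  have hW : W * star W = 1 := Unitary.coe_mul_star_self _
  have h : (star U * W) * (star U * W)ᴴ = 1 := by
    rw [← star_eq_conjTranspose, star_mul, star_star]
    calc star U * W * (star W * U) = star U * (W * star W) * U := by simp only [Matrix.mul_assoc]
      _ = 1 := by rw [hW, Matrix.mul_one, hU]
  have h' := congrFun (congrFun h i) i
  rw [mul_apply, one_apply_eq] at h'
  have : ((∑ j, hA.overlap hB i j : ℝ) : ℂ) = 1 := by
    rw [← h']
    push_cast
    refine Finset.sum_congr rfl fun j _ => ?_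
    rw [conjTranspose_apply, Complex.star_def, Complex.mul_conj, Complex.normSq_eq_norm_sq, overlap]
  exact_mod_cast this

/-- Expanding in both eigenbases turns a trace of noncommuting operators into a classical double
sum. -/
lemma trace_complexCfc_mul (f g : ℝ → ℂ) :
    trace (hA.complexCfc f * hB.complexCfc g) =
      ∑ i, ∑ j, f (hA.eigenvalues i) * g (hB.eigenvalues j) * hA.overlap hB i j := by
  set U := (hA.eigenvectorUnitary : Matrix n n ℂ) with hU
  set W := (hB.eigenvectorUnitary : Matrix n n ℂ) with hW
  have h : trace (hA.complexCfc f * hB.complexCfc g) =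
      trace (diagonal (fun i => f (hA.eigenvalues i)) * ((star U * W) *
        diagonal (fun j => g (hB.eigenvalues j)) * (star U * W)ᴴ)) := by
    rw [← star_eq_conjTranspose, star_mul, star_star, complexCfc, complexCfc, ← hU, ← hW,
      Matrix.mul_assoc U, Matrix.mul_assoc U, trace_mul_comm]
    simp only [Matrix.mul_assoc]
  rw [h, trace]
  refine Finset.sum_congr rfl fun i _ => ?_
  rw [diag_apply, diagonal_mul, mul_apply, Finset.mul_sum]
  refine Finset.sum_congr rfl fun j _ => ?_
  rw [mul_diagonal, conjTranspose_apply, overlap, ← hU, ← hW, Complex.star_def, Complex.ofReal_pow,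
    ← Complex.mul_conj']
  ring

lemma trace_complexCfc (f : ℝ → ℂ) :
    trace (hA.complexCfc f) = ∑ i, f (hA.eigenvalues i) := by
  rw [complexCfc, trace_mul_comm, ← Matrix.mul_assoc, Unitary.coe_star_mul_self, Matrix.one_mul,
    trace_diagonal]

end IsHermitian

/-! ### Hilbert–Schmidt norm and contractions -/

/-- The squared Hilbert–Schmidt norm. -/
noncomputable def hsNormSq (A : Matrix n n ℂ) : ℝ := ∑ i, ∑ j, ‖A i j‖ ^ 2

lemma hsNormSq_eq (A : Matrix n n ℂ) : (hsNormSq A : ℂ) = trace (A * Aᴴ) := by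
  simp only [hsNormSq, trace, diag_apply, mul_apply, conjTranspose_apply]
  push_cast
  refine Finset.sum_congr rfl fun i _ => Finset.sum_congr rfl fun j _ => ?_
  rw [Complex.star_def, Complex.mul_conj, Complex.normSq_eq_norm_sq, Complex.ofReal_pow]

lemma hsNormSq_nonneg (A : Matrix n n ℂ) : 0 ≤ hsNormSq A := by unfold hsNormSq; positivity

lemma hsNormSq_conjTranspose (A : Matrix n n ℂ) : hsNormSq Aᴴ = hsNormSq A := by
  have : (hsNormSq Aᴴ : ℂ) = hsNormSq A := by
    rw [hsNormSq_eq, hsNormSq_eq, conjTranspose_conjTranspose, trace_mul_comm]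
  exact_mod_cast this

lemma hsNormSq_mul_unitary [DecidableEq n] (A : Matrix n n ℂ) {U : Matrix n n ℂ} (hU : U * star U = 1) :
    hsNormSq (A * U) = hsNormSq A := by
  have : (hsNormSq (A * U) : ℂ) = hsNormSq A := by
    rw [hsNormSq_eq, hsNormSq_eq, conjTranspose_mul, Matrix.mul_assoc, ← Matrix.mul_assoc U,
      ← star_eq_conjTranspose U, hU, Matrix.one_mul]
  exact_mod_cast this

lemma hsNormSq_mul_diagonal_le [DecidableEq n] (A : Matrix n n ℂ) {d : n → ℂ} (hd : ∀ i, ‖d i‖ ≤ 1) :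
    hsNormSq (A * diagonal d) ≤ hsNormSq A := by
  unfold hsNormSq
  refine Finset.sum_le_sum fun i _ => Finset.sum_le_sum fun j _ => ?_
  rw [mul_diagonal, norm_mul]
  gcongr
  exact mul_le_of_le_one_right (norm_nonneg _) (hd j)

lemma hsNormSq_mul_complexCfc_le [DecidableEq n] (X : Matrix n n ℂ) {A : Matrix n n ℂ} (hA : A.IsHermitian)
    {f : ℝ → ℂ} (hf : ∀ i, ‖f (hA.eigenvalues i)‖ ≤ 1) :
    hsNormSq (X * hA.complexCfc f) ≤ hsNormSq X := by
  rw [IsHermitian.complexCfc, ← Matrix.mul_assoc, ← Matrix.mul_assoc,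
    hsNormSq_mul_unitary _ (by rw [star_star]; exact Unitary.coe_star_mul_self _)]
  refine (hsNormSq_mul_diagonal_le _ hf).trans ?_
  rw [hsNormSq_mul_unitary _ (Unitary.coe_mul_star_self _)]

lemma hsNormSq_complexCfc_mul_le [DecidableEq n] (X : Matrix n n ℂ) {A : Matrix n n ℂ} (hA : A.IsHermitian)
    {f : ℝ → ℂ} (hf : ∀ i, ‖f (hA.eigenvalues i)‖ ≤ 1) :
    hsNormSq (hA.complexCfc f * X) ≤ hsNormSq X := by
  rw [← hsNormSq_conjTranspose, conjTranspose_mul, hA.conjTranspose_complexCfc,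
    ← hsNormSq_conjTranspose X]
  exact hsNormSq_mul_complexCfc_le _ hA (by simpa using hf)

/-- Cauchy–Schwarz for the Hilbert–Schmidt inner product. -/
lemma norm_trace_mul_le (A B : Matrix n n ℂ) :
    ‖trace (A * B)‖ ≤ √(hsNormSq A) * √(hsNormSq B) := by
  rw [← hsNormSq_conjTranspose B, ← Real.sqrt_mul (hsNormSq_nonneg A)]
  refine Real.le_sqrt_of_sq_le ?_
  have h1 : ‖trace (A * B)‖ ≤ ∑ p : n × n, ‖A p.1 p.2‖ * ‖B p.2 p.1‖ := by
    rw [Fintype.sum_prod_type, trace]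
    refine (norm_sum_le _ _).trans (Finset.sum_le_sum fun i _ => ?_)
    rw [diag_apply, mul_apply]
    exact (norm_sum_le _ _).trans_eq (by simp only [norm_mul])
  calc ‖trace (A * B)‖ ^ 2 ≤ (∑ p : n × n, ‖A p.1 p.2‖ * ‖B p.2 p.1‖) ^ 2 := by gcongr
    _ ≤ (∑ p : n × n, ‖A p.1 p.2‖ ^ 2) * ∑ p : n × n, ‖B p.2 p.1‖ ^ 2 :=
      Finset.sum_mul_sq_le_sq_mul_sq _ _ _
    _ = _ := by simp [hsNormSq, Fintype.sum_prod_type]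

end Matrix

/-! ### Complex powers and bounded analytic functions on the strip -/

/-- The complex power of a nonnegative real number, with value `0` at the base `0` for every
exponent. -/
noncomputable def supportCpow (x : ℝ) (z : ℂ) : ℂ :=
  if x = 0 then 0 else Complex.exp (z * Real.log x)

/-- The value `0` at base `0`, even for exponent `0`, makes this law hold for all exponents; the
zeroth power of a matrix is then its support projection. -/
lemma supportCpow_mul (x : ℝ) (z w : ℂ) :
    supportCpow x z * supportCpow x w = supportCpow x (z + w) := by
  unfold supportCpow
  split_ifs
  · simp
  · rw [← Complex.exp_add, add_mul]

lemma supportCpow_ofReal {x : ℝ} (hx : 0 ≤ x) {s : ℝ} (hs : s ≠ 0) :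
    supportCpow x s = ((x ^ s : ℝ) : ℂ) := by
  unfold supportCpow
  split_ifs with h
  · simp [h, Real.zero_rpow hs]
  · rw [Real.rpow_def_of_pos (lt_of_le_of_ne hx (Ne.symm h))]
    push_cast
    rw [mul_comm]

lemma star_supportCpow_ofReal (x s : ℝ) : star (supportCpow x s) = supportCpow x s := by
  unfold supportCpow
  split_ifs
  · simp
  · rw [Complex.star_def, ← Complex.exp_conj]
    simp [Complex.conj_ofReal]

lemma norm_supportCpow_le (x : ℝ) (z : ℂ) :
    ‖supportCpow x z‖ ≤ Real.exp (|z.re| * |Real.log x|) := by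
  unfold supportCpow
  split_ifs
  · simpa using (Real.exp_pos _).le
  · rw [Complex.norm_exp, Real.exp_le_exp, Complex.re_mul_ofReal, ← abs_mul]
    exact le_abs_self _

lemma norm_supportCpow_le_one (x : ℝ) {z : ℂ} (hz : z.re = 0) : ‖supportCpow x z‖ ≤ 1 := by
  simpa [hz] using norm_supportCpow_le x z

open Complex.HadamardThreeLines in
/-- Entire functions that are bounded on the closed strip `0 ≤ re z ≤ 1`. -/
def IsStripBounded (g : ℂ → ℂ) : Prop :=
  Differentiable ℂ g ∧ ∃ C, ∀ z ∈ verticalClosedStrip 0 1, ‖g z‖ ≤ C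

namespace IsStripBounded

lemma const (c : ℂ) : IsStripBounded fun _ => c :=
  ⟨differentiable_const c, ‖c‖, fun _ _ => le_rfl⟩

lemma mul {f g : ℂ → ℂ} (hf : IsStripBounded f) (hg : IsStripBounded g) :
    IsStripBounded fun z => f z * g z := by
  obtain ⟨hf, C, hC⟩ := hf
  obtain ⟨hg, D, hD⟩ := hg
  refine ⟨hf.mul hg, C * D, fun z hz => ?_⟩
  rw [norm_mul]
  exact mul_le_mul (hC z hz) (hD z hz) (norm_nonneg _) ((norm_nonneg _).trans (hC z hz))

lemma sum {ι : Type*} (s : Finset ι) {f : ι → ℂ → ℂ} (hf : ∀ i, IsStripBounded (f i)) :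
    IsStripBounded fun z => ∑ i ∈ s, f i z := by
  choose hf C hC using hf
  refine ⟨Differentiable.fun_sum fun i _ => hf i, ∑ i ∈ s, C i, fun z hz => ?_⟩
  exact (norm_sum_le _ _).trans (Finset.sum_le_sum fun i _ => hC i z hz)

lemma supportCpow (x a b : ℝ) : IsStripBounded fun z => supportCpow x (a + b * z) := by
  constructor
  · unfold _root_.supportCpow
    split_ifs
    · exact differentiable_const 0
    · fun_prop
  · refine ⟨Real.exp ((|a| + |b|) * |Real.log x|), fun z hz => ?_⟩
    refine (norm_supportCpow_le _ _).trans ?_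
    have hz' : 0 ≤ z.re ∧ z.re ≤ 1 := hz
    have h : |a + b * z.re| ≤ |a| + |b| := by
      refine (abs_add_le _ _).trans ?_
      rw [abs_mul, abs_of_nonneg hz'.1]
      gcongr
      exact mul_le_of_le_one_right (abs_nonneg _) hz'.2
    simp only [Complex.add_re, Complex.ofReal_re, Complex.re_ofReal_mul]
    gcongr

variable {n : Type*} [Fintype n]

lemma matrix_mul {P Q : ℂ → Matrix n n ℂ} (hP : ∀ i j, IsStripBounded fun z => P z i j)
    (hQ : ∀ i j, IsStripBounded fun z => Q z i j) (i j : n) :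
    IsStripBounded fun z => (P z * Q z) i j := by
  simp only [Matrix.mul_apply]
  exact sum _ fun k => (hP i k).mul (hQ k j)

lemma complexCfc_supportCpow [DecidableEq n] {A : Matrix n n ℂ} (hA : A.IsHermitian) (a b : ℝ)
    (i j : n) :
    IsStripBounded fun z => hA.complexCfc (fun x => _root_.supportCpow x (a + b * z)) i j := by
  refine matrix_mul
    (P := fun z => (hA.eigenvectorUnitary : Matrix n n ℂ) *
      Matrix.diagonal fun i => _root_.supportCpow (hA.eigenvalues i) (a + b * z))
    (Q := fun _ => star (hA.eigenvectorUnitary : Matrix n n ℂ))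
    (matrix_mul (P := fun _ => (hA.eigenvectorUnitary : Matrix n n ℂ))
      (fun _ _ => const _) fun k l => ?_) (fun _ _ => const _) i j
  by_cases h : k = l
  · subst h
    simp only [Matrix.diagonal_apply_eq]
    exact supportCpow _ a b
  · simp only [Matrix.diagonal_apply_ne _ h]
    exact const 0

end IsStripBounded

/-! ### The Araki–Lieb–Thirring inequality -/

section

variable {n : Type*} [Fintype n] [DecidableEq n]

open Matrix

/-- Exponent `0` is excluded because `(0 : ℝ) ^ (0 : ℝ) = 1`, whereas `supportCpow 0 0 = 0`. -/
lemma opPow_eq_complexCfc {A : Matrix n n ℂ} (hA : A.PosSemidef) {s : ℝ} (hs : s ≠ 0) :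
    opPow A s = hA.1.complexCfc (fun x => supportCpow x s) := by
  rw [opPow, hA.1.cfc_eq_complexCfc]
  exact hA.1.complexCfc_congr fun i => (supportCpow_ofReal (hA.eigenvalues_nonneg i) hs).symm

lemma eq_complexCfc_supportCpow {A : Matrix n n ℂ} (hA : A.PosSemidef) :
    A = hA.1.complexCfc (fun x => supportCpow x 1) := by
  conv_lhs => rw [← hA.1.complexCfc_id]
  refine hA.1.complexCfc_congr fun i => ?_
  rw [← Complex.ofReal_one, supportCpow_ofReal (hA.eigenvalues_nonneg i) one_ne_zero,
    Real.rpow_one]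

lemma Matrix.IsHermitian.complexCfc_supportCpow_mul {A : Matrix n n ℂ} (hA : A.IsHermitian)
    (z w : ℂ) :
    hA.complexCfc (fun x => supportCpow x z) * hA.complexCfc (fun x => supportCpow x w) =
      hA.complexCfc (fun x => supportCpow x (z + w)) := by
  rw [hA.complexCfc_mul]
  simp only [supportCpow_mul]

lemma Matrix.IsHermitian.conjTranspose_complexCfc_supportCpow {A : Matrix n n ℂ}
    (hA : A.IsHermitian) (s : ℝ) :
    (hA.complexCfc (fun x => supportCpow x s))ᴴ = hA.complexCfc (fun x => supportCpow x s) := by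
  rw [hA.conjTranspose_complexCfc]
  simp only [star_supportCpow_ofReal]

lemma conjTranspose_opPow {A : Matrix n n ℂ} (hA : A.IsHermitian) (s : ℝ) :
    (opPow A s)ᴴ = opPow A s := by
  rw [opPow, hA.cfc_eq_complexCfc, hA.conjTranspose_complexCfc]
  simp

lemma posSemidef_opPow_mul_mul {A B : Matrix n n ℂ} (hA : A.PosSemidef) (hB : B.PosSemidef)
    (s : ℝ) : (opPow B s * A * opPow B s).PosSemidef := by
  have := hA.mul_mul_conjTranspose_same (opPow B s)
  rwa [conjTranspose_opPow hB.1] at this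

lemma hsNormSq_complexCfc_supportCpow {A : Matrix n n ℂ} (hA : A.PosSemidef) {s : ℝ}
    (hs : s ≠ 0) :
    hsNormSq (hA.1.complexCfc (fun x => supportCpow x ((s / 2 : ℝ) : ℂ))) =
      reTrace (opPow A s) := by
  rw [reTrace, opPow_eq_complexCfc hA hs, ← Complex.ofReal_re (hsNormSq _), hsNormSq_eq,
    hA.1.conjTranspose_complexCfc_supportCpow, hA.1.complexCfc_supportCpow_mul]
  norm_num

lemma hsNormSq_complexCfc_supportCpow_mul {A B : Matrix n n ℂ} (hA : A.PosSemidef)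
    (hB : B.PosSemidef) {s t : ℝ} (hs : s ≠ 0) (ht : t ≠ 0) :
    hsNormSq (hA.1.complexCfc (fun x => supportCpow x ((s / 2 : ℝ) : ℂ)) *
      hB.1.complexCfc (fun x => supportCpow x ((t / 2 : ℝ) : ℂ))) =
      reTrace (opPow A s * opPow B t) := by
  rw [reTrace, opPow_eq_complexCfc hA hs, opPow_eq_complexCfc hB ht,
    ← Complex.ofReal_re (hsNormSq _), hsNormSq_eq, conjTranspose_mul,
    hA.1.conjTranspose_complexCfc_supportCpow, hB.1.conjTranspose_complexCfc_supportCpow,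
    Matrix.mul_assoc, ← Matrix.mul_assoc (hB.1.complexCfc _), hB.1.complexCfc_supportCpow_mul,
    ← Matrix.mul_assoc, Matrix.trace_mul_comm, ← Matrix.mul_assoc,
    hA.1.complexCfc_supportCpow_mul]
  norm_num

/-- The case `q = 1` of the Araki–Lieb–Thirring inequality, for `B ^ (1 - p)`. -/
theorem reTrace_opPow_sandwich_le {A B : Matrix n n ℂ} (hA : A.PosSemidef) (hB : B.PosSemidef)
    {p : ℝ} (hp : 1 < p) :
    reTrace (opPow (opPow B (-((p - 1) / p) / 2) * A * opPow B (-((p - 1) / p) / 2)) p) ≤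
      reTrace (opPow A p * opPow B (1 - p)) := by
  have hp0 : p ≠ 0 := by positivity
  have hp1 : 1 - p ≠ 0 := by linarith
  have hp2 : p - 1 ≠ 0 := by linarith
  have hs : -((p - 1) / p) / 2 ≠ 0 := by
    simp [hp0, hp2]
  have hM : (opPow B (-((p - 1) / p) / 2) * A * opPow B (-((p - 1) / p) / 2)).PosSemidef :=
    posSemidef_opPow_mul_mul hA hB _
  set M := opPow B (-((p - 1) / p) / 2) * A * opPow B (-((p - 1) / p) / 2) with hM_def
  set m := reTrace (opPow M p) with hm
  set q := reTrace (opPow A p * opPow B (1 - p)) with hq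
  have hm' := hsNormSq_complexCfc_supportCpow hM hp0
  have hq' := hsNormSq_complexCfc_supportCpow_mul hA hB hp0 hp1
  rw [← hm] at hm'
  rw [← hq] at hq'
  have hm0 : 0 ≤ m := hm' ▸ hsNormSq_nonneg _
  have hq0 : 0 ≤ q := hq' ▸ hsNormSq_nonneg _
  let P : ℂ → Matrix n n ℂ := fun z => hM.1.complexCfc (fun x => supportCpow x z)
  let R : ℂ → Matrix n n ℂ := fun z => hA.1.complexCfc (fun x => supportCpow x z)
  let S : ℂ → Matrix n n ℂ := fun z => hB.1.complexCfc (fun x => supportCpow x z)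
  have hP (z w) : P z * P w = P (z + w) := hM.1.complexCfc_supportCpow_mul z w
  have hR (z w) : R z * R w = R (z + w) := hA.1.complexCfc_supportCpow_mul z w
  have hS (z w) : S z * S w = S (z + w) := hB.1.complexCfc_supportCpow_mul z w
  have hPr (X) {z : ℂ} (hz : z.re = 0) : hsNormSq (X * P z) ≤ hsNormSq X :=
    hsNormSq_mul_complexCfc_le X hM.1 fun _ => norm_supportCpow_le_one _ hz
  have hPl (X) {z : ℂ} (hz : z.re = 0) : hsNormSq (P z * X) ≤ hsNormSq X :=
    hsNormSq_complexCfc_mul_le X hM.1 fun _ => norm_supportCpow_le_one _ hz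
  have hRr (X) {z : ℂ} (hz : z.re = 0) : hsNormSq (X * R z) ≤ hsNormSq X :=
    hsNormSq_mul_complexCfc_le X hA.1 fun _ => norm_supportCpow_le_one _ hz
  have hRl (X) {z : ℂ} (hz : z.re = 0) : hsNormSq (R z * X) ≤ hsNormSq X :=
    hsNormSq_complexCfc_mul_le X hA.1 fun _ => norm_supportCpow_le_one _ hz
  have hSr (X) {z : ℂ} (hz : z.re = 0) : hsNormSq (X * S z) ≤ hsNormSq X :=
    hsNormSq_mul_complexCfc_le X hB.1 fun _ => norm_supportCpow_le_one _ hz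
  have hSl (X) {z : ℂ} (hz : z.re = 0) : hsNormSq (S z * X) ≤ hsNormSq X :=
    hsNormSq_complexCfc_mul_le X hB.1 fun _ => norm_supportCpow_le_one _ hz
  let F : ℂ → ℂ := fun z => trace (P ((p : ℝ) + (-p : ℝ) * z) *
    (S ((0 : ℝ) + ((1 - p) / 2 : ℝ) * z) * R ((0 : ℝ) + p * z) *
      S ((0 : ℝ) + ((1 - p) / 2 : ℝ) * z)))
  have hF : IsStripBounded F := by
    refine IsStripBounded.sum _ fun i => ?_
    refine IsStripBounded.matrix_mul (IsStripBounded.complexCfc_supportCpow _ _ _)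
      (IsStripBounded.matrix_mul (IsStripBounded.matrix_mul ?_ ?_) ?_) i i <;>
    exact IsStripBounded.complexCfc_supportCpow _ _ _
  have h0 : ∀ z ∈ Complex.re ⁻¹' {0}, ‖F z‖ ≤ m := by
    intro z hz
    have hz : z.re = 0 := hz
    -- Splitting off `M ^ (p/2)` twice leaves only imaginary powers, so both factors have
    -- Hilbert–Schmidt norm at most `√m`.
    have h : F z = trace (P ((p / 2 : ℝ) : ℂ) * (P ((p / 2 : ℝ) : ℂ) * P ((-p : ℝ) * z) *
        S ((0 : ℝ) + ((1 - p) / 2 : ℝ) * z) * R ((0 : ℝ) + p * z) *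
          S ((0 : ℝ) + ((1 - p) / 2 : ℝ) * z))) := by
      simp only [← Matrix.mul_assoc, hP, F]
      congr 5
      push_cast
      ring
    rw [h]
    refine (norm_trace_mul_le _ _).trans ?_
    rw [← Real.mul_self_sqrt hm0, ← hm']
    refine mul_le_mul_of_nonneg_left (Real.sqrt_le_sqrt ?_) (Real.sqrt_nonneg _)
    refine (hSr _ (by simp [hz])).trans ((hRr _ (by simp [hz])).trans
      ((hSr _ (by simp [hz])).trans (hPr _ ?_)))
    rw [Complex.re_ofReal_mul, hz, mul_zero]
  have h1 : ∀ z ∈ Complex.re ⁻¹' {1}, ‖F z‖ ≤ q := by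
    intro z hz
    have hz : z.re = 1 := hz
    -- With `G = A ^ (p/2) * B ^ ((1-p)/2)`, whose squared norm is `q`, the product is `Gᴴ` times
    -- `G` up to imaginary powers.
    have h : F z = trace ((P ((p : ℝ) + (-p : ℝ) * z) * S (((1 - p) / 2 : ℝ) * (z - 1)) *
        (R ((p / 2 : ℝ) : ℂ) * S (((1 - p) / 2 : ℝ) : ℂ))ᴴ) *
        (R ((p : ℝ) * (z - 1)) * (R ((p / 2 : ℝ) : ℂ) * S (((1 - p) / 2 : ℝ) : ℂ)) *
          S (((1 - p) / 2 : ℝ) * (z - 1)))) := by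
      have e1 : S (((1 - p) / 2 : ℝ) * (z - 1)) * S (((1 - p) / 2 : ℝ) : ℂ) =
          S ((0 : ℝ) + ((1 - p) / 2 : ℝ) * z) := by
        rw [hS]; congr 1; push_cast; ring
      have e2 : S (((1 - p) / 2 : ℝ) : ℂ) * S (((1 - p) / 2 : ℝ) * (z - 1)) =
          S ((0 : ℝ) + ((1 - p) / 2 : ℝ) * z) := by
        rw [hS]; congr 1; push_cast; ring
      have e3 : R ((p / 2 : ℝ) : ℂ) * R ((p : ℝ) * (z - 1)) * R ((p / 2 : ℝ) : ℂ) =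
          R ((0 : ℝ) + p * z) := by
        rw [hR, hR]; congr 1; push_cast; ring
      have e4 : (R ((p / 2 : ℝ) : ℂ) * S (((1 - p) / 2 : ℝ) : ℂ))ᴴ =
          S (((1 - p) / 2 : ℝ) : ℂ) * R ((p / 2 : ℝ) : ℂ) := by
        rw [conjTranspose_mul]
        congr 1
        · exact hB.1.conjTranspose_complexCfc_supportCpow _
        · exact hA.1.conjTranspose_complexCfc_supportCpow _
      rw [e4]
      change trace (_ * (_ * _ * _)) = _
      conv_lhs => rw [← e3]
      conv_lhs => enter [1, 2, 1, 1]; rw [← e1]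
      conv_lhs => enter [1, 2, 2]; rw [← e2]
      simp only [Matrix.mul_assoc]
    rw [h]
    refine (norm_trace_mul_le _ _).trans ?_
    rw [← Real.mul_self_sqrt hq0, ← hq']
    refine mul_le_mul (Real.sqrt_le_sqrt ?_) (Real.sqrt_le_sqrt ?_) (Real.sqrt_nonneg _)
      (Real.sqrt_nonneg _)
    · rw [Matrix.mul_assoc]
      refine (hPl _ ?_).trans ((hSl _ ?_).trans_eq (hsNormSq_conjTranspose _))
      · rw [Complex.add_re, Complex.re_ofReal_mul, hz, Complex.ofReal_re]; ring
      · rw [Complex.re_ofReal_mul, Complex.sub_re, hz]; simp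
    · refine (hSr _ ?_).trans (hRl _ ?_)
      · rw [Complex.re_ofReal_mul, Complex.sub_re, hz]; simp
      · rw [Complex.re_ofReal_mul, Complex.sub_re, hz]; simp
  have hFp : F ((1 / p : ℝ) : ℂ) = m := by
    have hpc : (p : ℂ) ≠ 0 := by exact_mod_cast hp0
    have e1 : S ((0 : ℝ) + ((1 - p) / 2 : ℝ) * ((1 / p : ℝ) : ℂ)) =
        opPow B (-((p - 1) / p) / 2) := by
      rw [opPow_eq_complexCfc hB hs]
      change S _ = S _
      congr 1
      push_cast
      field_simp
      ring
    have e2 : R ((0 : ℝ) + p * ((1 / p : ℝ) : ℂ)) = A := by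
      conv_rhs => rw [eq_complexCfc_supportCpow hA]
      change R _ = R _
      congr 1
      push_cast
      field_simp
      ring
    have e3 : P ((p : ℝ) + (-p : ℝ) * ((1 / p : ℝ) : ℂ)) * M = opPow M p := by
      have hM1 : M = P 1 := eq_complexCfc_supportCpow hM
      conv_lhs => enter [2]; rw [hM1]
      rw [hP, opPow_eq_complexCfc hM hp0]
      change P _ = P _
      congr 1
      push_cast
      field_simp
      ring
    change trace (_ * (_ * _ * _)) = _
    rw [e1, e2, ← hM_def, e3, hm, reTrace, opPow, hM.1.cfc_eq_complexCfc, hM.1.trace_complexCfc]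
    rw [← Complex.ofReal_sum, Complex.ofReal_re]
  have hmem : ((1 / p : ℝ) : ℂ) ∈ Complex.HadamardThreeLines.verticalClosedStrip 0 1 := by
    refine ⟨?_, ?_⟩
    · rw [Complex.ofReal_re]; positivity
    · rw [Complex.ofReal_re, div_le_one (by positivity)]; exact hp.le
  have key := Complex.HadamardThreeLines.norm_le_interp_of_mem_verticalClosedStrip₀₁' F hmem
    hF.1.diffContOnCl (by
      obtain ⟨C, hC⟩ := hF.2
      refine ⟨C, ?_⟩
      rintro _ ⟨z, hz, rfl⟩
      exact hC z hz) h0 h1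
  rw [hFp, Complex.norm_real, Real.norm_of_nonneg hm0, Complex.ofReal_re] at key
  -- The case `m = 0` is separate because a factor `m` is cancelled below.
  rcases hm0.eq_or_lt with h | hmpos
  · rw [← h]; exact hq0
  rw [Real.rpow_sub hmpos, Real.rpow_one, div_mul_eq_mul_div, le_div_iff₀ (by positivity),
    mul_le_mul_iff_right₀ hmpos] at key
  exact (Real.rpow_le_rpow_iff hm0 hq0 (by positivity)).1 key

/-! ### Positivity and supports -/

lemma reTrace_opPow_pos {M : Matrix n n ℂ} (hM : M.PosSemidef) (h : M ≠ 0) (p : ℝ) :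
    0 < reTrace (opPow M p) := by
  rw [reTrace, opPow, hM.1.cfc_eq_complexCfc, hM.1.trace_complexCfc, ← Complex.ofReal_sum,
    Complex.ofReal_re]
  have hne : hM.1.eigenvalues ≠ 0 := fun h' => h (hM.1.eigenvalues_eq_zero_iff.1 h')
  obtain ⟨i, hi⟩ := Function.ne_iff.1 hne
  refine Finset.sum_pos' (fun i _ => Real.rpow_nonneg (hM.eigenvalues_nonneg i) _)
    ⟨i, Finset.mem_univ _, Real.rpow_pos_of_pos ?_ _⟩
  exact lt_of_le_of_ne (hM.eigenvalues_nonneg i) (Ne.symm hi)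

/-- A matrix whose range lies in the range of `B` factors through `B`. -/
lemma exists_eq_mul_of_opSupport_le {A B : Matrix n n ℂ} (h : opSupport A ≤ opSupport B) :
    ∃ X : Matrix n n ℂ, A = B * X := by
  have h' (k : n) : ∃ v, B.mulVecLin v = A.col k :=
    h ⟨Pi.single k 1, by simp⟩
  choose v hv using h'
  refine ⟨Matrix.of fun i k => v k i, ?_⟩
  ext i k
  have := congrFun (hv k) i
  rw [Matrix.mulVecLin_apply] at this
  rw [Matrix.mul_apply]
  exact this.symm

/-- On a support contained in that of `B`, conjugation by a power of `B` is injective. -/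
lemma opPow_sandwich_ne_zero {A B : Matrix n n ℂ} (hA : A.PosSemidef) (hB : B.PosSemidef)
    (hA0 : A ≠ 0) (h : opSupport A ≤ opSupport B) {s : ℝ} (hs : s ≠ 0) :
    opPow B s * A * opPow B s ≠ 0 := by
  intro h0
  obtain ⟨X, hX⟩ := exists_eq_mul_of_opSupport_le h
  let S : ℂ → Matrix n n ℂ := fun z => hB.1.complexCfc (fun x => supportCpow x z)
  have hS (z w) : S z * S w = S (z + w) := hB.1.complexCfc_supportCpow_mul z w
  -- `S 0` is the projection onto the support of `B`, which contains that of `A`.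
  have h1 : S 0 * A = A := by
    rw [hX, ← Matrix.mul_assoc]
    conv_lhs => enter [1, 2]; rw [eq_complexCfc_supportCpow hB]
    conv_rhs => enter [1]; rw [eq_complexCfc_supportCpow hB]
    congr 1
    change S 0 * S 1 = S 1
    rw [hS, zero_add]
  have h2 : A * S 0 = A := by
    have := congrArg conjTranspose h1
    rw [conjTranspose_mul, hA.1.eq] at this
    have h3 : (S 0)ᴴ = S 0 := by
      have := hB.1.conjTranspose_complexCfc_supportCpow 0
      rwa [Complex.ofReal_zero] at this
    rwa [h3] at this
  apply hA0
  rw [opPow_eq_complexCfc hB hs] at h0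
  change S s * A * S s = 0 at h0
  calc A = S 0 * A * S 0 := by rw [h1, h2]
    _ = S (-s) * (S s * A * S s) * S (-s) := by
      have e1 : S 0 = S (-s) * S s := by rw [hS]; simp
      have e2 : S 0 = S s * S (-s) := by rw [hS]; simp
      conv_lhs => enter [1, 1]; rw [e1]
      conv_lhs => enter [2]; rw [e2]
      simp only [Matrix.mul_assoc]
    _ = 0 := by rw [h0]; simp

/-- An eigenvector of `B` for `0` is orthogonal to the range of `B`, hence to that of `A`, which
contains the eigenvectors of `A` with nonzero eigenvalue. -/
lemma overlap_eq_zero_of_opSupport_le {A B : Matrix n n ℂ} (hA : A.IsHermitian)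
    (hB : B.IsHermitian) (h : opSupport A ≤ opSupport B) {i j : n} (hi : hA.eigenvalues i ≠ 0)
    (hj : hB.eigenvalues j = 0) : hA.overlap hB i j = 0 := by
  obtain ⟨X, hX⟩ := exists_eq_mul_of_opSupport_le h
  set U := (hA.eigenvectorUnitary : Matrix n n ℂ) with hU
  set W := (hB.eigenvectorUnitary : Matrix n n ℂ) with hW
  have hUU : star U * U = 1 := Unitary.coe_star_mul_self _
  have hWW : star W * W = 1 := Unitary.coe_star_mul_self _
  have eA : A * U = U * diagonal (fun i => (hA.eigenvalues i : ℂ)) := by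
    conv_lhs => rw [← hA.complexCfc_id]
    rw [IsHermitian.complexCfc, ← hU, Matrix.mul_assoc, hUU, Matrix.mul_one]
  have eB : star W * B = diagonal (fun i => (hB.eigenvalues i : ℂ)) * star W := by
    conv_lhs => rw [← hB.complexCfc_id]
    rw [IsHermitian.complexCfc, ← hW, ← Matrix.mul_assoc, ← Matrix.mul_assoc, hWW, Matrix.one_mul]
  have e : star W * U * diagonal (fun i => (hA.eigenvalues i : ℂ)) =
      diagonal (fun i => (hB.eigenvalues i : ℂ)) * (star W * X * U) := by
    rw [Matrix.mul_assoc, ← eA, hX, ← Matrix.mul_assoc, ← Matrix.mul_assoc, eB]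
    simp only [Matrix.mul_assoc]
  have e' := congrFun (congrFun e j) i
  rw [mul_diagonal, diagonal_mul, hj, Complex.ofReal_zero, zero_mul, mul_eq_zero] at e'
  have e'' : (star W * U) j i = 0 := e'.resolve_right (by exact_mod_cast hi)
  have e3 : (star U * W) i j = star ((star W * U) j i) := by
    rw [← conjTranspose_apply, ← star_eq_conjTranspose, star_mul, star_star]
  rw [IsHermitian.overlap, ← hU, ← hW, e3, e'']
  simp

end

/-! ### Scalar inequalities and the cumulant bound -/

lemma Real.exp_le_quadratic_add_cubic (x : ℝ) :
    Real.exp x ≤ 1 + x + x ^ 2 / 2 + (max x 0) ^ 3 / 6 * Real.exp x := by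
  rcases le_total x 0 with hx | hx
  · rw [max_eq_right hx]
    have h := Real.quadratic_le_exp_of_nonneg (x := -x) (by linarith)
    have h1 : Real.exp x * Real.exp (-x) = 1 := by rw [← Real.exp_add]; simp
    have h2 : Real.exp x * (1 + -x + (-x) ^ 2 / 2) ≤ 1 := by
      refine le_of_le_of_eq ?_ h1
      exact mul_le_mul_of_nonneg_left h (Real.exp_pos x).le
    have h3 : 0 < 1 + -x + (-x) ^ 2 / 2 := by nlinarith
    -- The product equals `1 + x ^ 4 / 4`.
    have h4 : 1 ≤ (1 + x + x ^ 2 / 2) * (1 + -x + (-x) ^ 2 / 2) := by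
      nlinarith [sq_nonneg (x ^ 2)]
    have := le_of_mul_le_mul_right (h2.trans h4) h3
    simpa using this
  · rw [max_eq_left hx]
    -- The claim divided by `exp y` reads `h 0 ≤ h y`; the derivative of `h` is nonnegative on `[0,
    -- ∞)`.
    let h : ℝ → ℝ := fun y => (1 + y + y ^ 2 / 2) * Real.exp (-y) + y ^ 3 / 6
    have hd (y : ℝ) : HasDerivAt h (y ^ 2 / 2 * (1 - Real.exp (-y))) y := by
      have h1 : HasDerivAt (fun y : ℝ => Real.exp (-y)) (Real.exp (-y) * -1) y :=
        (hasDerivAt_neg y).exp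
      have h2 : HasDerivAt (fun y : ℝ => 1 + y + y ^ 2 / 2) (1 + y) y := by
        have := ((hasDerivAt_id y).const_add 1).add ((hasDerivAt_pow 2 y).div_const 2)
        refine this.congr_deriv ?_
        norm_num
      have h3 : HasDerivAt (fun y : ℝ => y ^ 3 / 6) (y ^ 2 / 2) y := by
        refine ((hasDerivAt_pow 3 y).div_const 6).congr_deriv ?_
        norm_num
        ring
      refine ((h2.mul h1).add h3).congr_deriv ?_
      ring
    have hm : MonotoneOn h (Set.Ici 0) := by
      refine monotoneOn_of_deriv_nonneg (convex_Ici 0)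
        (fun y _ => (hd y).continuousAt.continuousWithinAt)
        (fun y _ => (hd y).differentiableAt.differentiableWithinAt) fun y hy => ?_
      rw [interior_Ici] at hy
      rw [(hd y).deriv]
      have : Real.exp (-y) ≤ 1 := Real.exp_le_one_iff.2 (by linarith [hy.out])
      have : 0 ≤ 1 - Real.exp (-y) := by linarith
      positivity
    have h0 := hm Set.self_mem_Ici hx hx
    simp only [h] at h0
    norm_num at h0
    have h1 : Real.exp (-x) * Real.exp x = 1 := by rw [← Real.exp_add]; simp
    have h2 := mul_le_mul_of_nonneg_right h0 (Real.exp_pos x).le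
    rw [add_mul, mul_assoc, h1] at h2
    linarith

/-- The derivative `3 (log x / √x) ^ 2` decreases because `log x / √x` is nonnegative and decreasing
from `e²` on. -/
lemma Real.concaveOn_log_pow_three : ConcaveOn ℝ (Set.Ici (Real.exp 2)) fun x => Real.log x ^ 3 := by
  have hpos {x : ℝ} (hx : x ∈ Set.Ici (Real.exp 2)) : 0 < x := (Real.exp_pos 2).trans_le hx
  have hd {x : ℝ} (hx : x ∈ Set.Ici (Real.exp 2)) :
      HasDerivAt (fun x => Real.log x ^ 3) (3 * (Real.log x / √x) ^ 2) x := by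
    refine ((Real.hasDerivAt_log (hpos hx).ne').pow 3).congr_deriv ?_
    rw [div_pow, Real.sq_sqrt (hpos hx).le]
    norm_num
    ring
  refine AntitoneOn.concaveOn_of_deriv (convex_Ici _)
    (fun x hx => (hd hx).continuousAt.continuousWithinAt)
    (fun x hx => (hd (interior_subset hx)).differentiableAt.differentiableWithinAt) ?_
  intro x hx y hy hxy
  have hx' := interior_subset hx
  have hy' := interior_subset hy
  rw [(hd hx').deriv, (hd hy').deriv]
  have hlog : 0 ≤ Real.log y :=
    (by norm_num : (0 : ℝ) ≤ 2).trans ((Real.le_log_iff_exp_le (hpos hy')).2 hy')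
  have := Real.log_div_sqrt_antitoneOn hx' hy' hxy
  have : 0 ≤ Real.log y / √y := by positivity
  gcongr

section

variable {ι : Type*} [Fintype ι] {w Y : ι → ℝ}

/-- A second-order bound, with explicit remainder, on the cumulant generating function of a centred
random variable with finitely many values. -/
theorem log_sum_mul_exp_le (hw : ∀ i, 0 ≤ w i) (hw1 : ∑ i, w i = 1) (hY : ∑ i, w i * Y i = 0)
    {t μ : ℝ} (ht : 0 ≤ t) (hμ : 0 < μ) :
    Real.log (∑ i, w i * Real.exp (t * Y i)) ≤ t ^ 2 / 2 * ∑ i, w i * Y i ^ 2 +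
      t ^ 3 / (6 * μ ^ 3) * (∑ i, w i * Real.exp (t * Y i)) *
        Real.log (∑ i, w i * Real.exp ((t + μ) * Y i) + Real.exp 2) ^ 3 := by
  set Z := ∑ i, w i * Real.exp (t * Y i) with hZ
  have hZ1 : 1 ≤ Z := by
    calc (1 : ℝ) = ∑ i, (w i + t * (w i * Y i)) := by
          rw [Finset.sum_add_distrib, ← Finset.mul_sum, hw1, hY]; ring
      _ ≤ Z := Finset.sum_le_sum fun i _ => by
          have := mul_le_mul_of_nonneg_left (Real.add_one_le_exp (t * Y i)) (hw i)
          linarith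
  have hZ0 : 0 < Z := by linarith
  have hcubic : ∑ i, w i * Real.exp (t * Y i) * (max (μ * Y i) 0) ^ 3 ≤
      Z * Real.log (∑ i, w i * Real.exp ((t + μ) * Y i) + Real.exp 2) ^ 3 := by
    have hv0 (i : ι) : 0 ≤ w i * Real.exp (t * Y i) / Z :=
      div_nonneg (mul_nonneg (hw i) (Real.exp_pos _).le) hZ0.le
    have hv1 : ∑ i, w i * Real.exp (t * Y i) / Z = 1 := by
      rw [← Finset.sum_div, ← hZ, div_self hZ0.ne']
    -- Jensen under the tilted law `w e^{tY} / Z`, where the mean of `e^{μY}` is the moment at `t +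
    -- μ` divided by `Z`; the bound `Z ≥ 1` then removes this division.
    have hJ := Real.concaveOn_log_pow_three.le_map_sum (t := Finset.univ)
      (w := fun i => w i * Real.exp (t * Y i) / Z)
      (p := fun i => Real.exp (μ * Y i) + Real.exp 2) (fun i _ => hv0 i) hv1
      (fun i _ => by simpa using (Real.exp_pos _).le)
    have hmean : ∑ i, (w i * Real.exp (t * Y i) / Z) • (Real.exp (μ * Y i) + Real.exp 2) =
        (∑ i, w i * Real.exp ((t + μ) * Y i)) / Z + Real.exp 2 := by
      simp only [smul_eq_mul, mul_add, Finset.sum_add_distrib, ← Finset.sum_mul, hv1, one_mul,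
        Finset.sum_div]
      congr 1
      refine Finset.sum_congr rfl fun i _ => ?_
      rw [add_mul, Real.exp_add]
      ring
    rw [hmean] at hJ
    have hS0 : 0 ≤ ∑ i, w i * Real.exp ((t + μ) * Y i) :=
      Finset.sum_nonneg fun i _ => mul_nonneg (hw i) (Real.exp_pos _).le
    have hpos : 0 < (∑ i, w i * Real.exp ((t + μ) * Y i)) / Z + Real.exp 2 := by positivity
    have hlog0 : 0 ≤ Real.log ((∑ i, w i * Real.exp ((t + μ) * Y i)) / Z + Real.exp 2) := by
      refine Real.log_nonneg ?_
      have : 1 ≤ Real.exp 2 := Real.one_le_exp (by norm_num)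
      have : 0 ≤ (∑ i, w i * Real.exp ((t + μ) * Y i)) / Z := by positivity
      linarith
    have hmono : Real.log ((∑ i, w i * Real.exp ((t + μ) * Y i)) / Z + Real.exp 2) ^ 3 ≤
        Real.log (∑ i, w i * Real.exp ((t + μ) * Y i) + Real.exp 2) ^ 3 := by
      gcongr
      exact div_le_self hS0 hZ1
    refine le_trans ?_ (mul_le_mul_of_nonneg_left (hJ.trans hmono) hZ0.le)
    rw [Finset.mul_sum]
    refine Finset.sum_le_sum fun i _ => ?_
    rw [smul_eq_mul, ← mul_assoc, mul_div_cancel₀ _ hZ0.ne']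
    refine mul_le_mul_of_nonneg_left ?_ (mul_nonneg (hw i) (Real.exp_pos _).le)
    -- The positive part of `μY` is at most `log (e^{μY} + e²)`.
    refine pow_le_pow_left₀ (le_max_right _ _) (max_le ?_ ?_) 3
    · rw [Real.le_log_iff_exp_le (by positivity)]
      linarith [Real.exp_pos 2]
    · refine Real.log_nonneg ?_
      have : 1 ≤ Real.exp 2 := Real.one_le_exp (by norm_num)
      linarith [Real.exp_pos (μ * Y i)]
  have hscale (i : ι) : (max (t * Y i) 0) ^ 3 = t ^ 3 / μ ^ 3 * (max (μ * Y i) 0) ^ 3 := by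
    have h1 : max (t * Y i) 0 = t * max (Y i) 0 := by
      rw [mul_max_of_nonneg _ _ ht, mul_zero]
    have h2 : max (μ * Y i) 0 = μ * max (Y i) 0 := by
      rw [mul_max_of_nonneg _ _ hμ.le, mul_zero]
    rw [h1, h2]
    field_simp
  calc Real.log Z ≤ Z - 1 := Real.log_le_sub_one_of_pos hZ0
    _ ≤ ∑ i, w i * (1 + t * Y i + (t * Y i) ^ 2 / 2 +
          (max (t * Y i) 0) ^ 3 / 6 * Real.exp (t * Y i)) - 1 := by
      refine sub_le_sub_right (Finset.sum_le_sum fun i _ => ?_) 1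
      exact mul_le_mul_of_nonneg_left (Real.exp_le_quadratic_add_cubic _) (hw i)
    _ = ∑ i, (w i + t * (w i * Y i) + t ^ 2 / 2 * (w i * Y i ^ 2) + t ^ 3 / (6 * μ ^ 3) *
          (w i * Real.exp (t * Y i) * (max (μ * Y i) 0) ^ 3)) - 1 := by
      congr 1
      refine Finset.sum_congr rfl fun i _ => ?_
      rw [hscale]
      ring
    _ = t ^ 2 / 2 * ∑ i, w i * Y i ^ 2 + t ^ 3 / (6 * μ ^ 3) *
          ∑ i, w i * Real.exp (t * Y i) * (max (μ * Y i) 0) ^ 3 := by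
      simp only [Finset.sum_add_distrib, ← Finset.mul_sum, hw1, hY]
      ring
    _ ≤ _ := by
      rw [mul_assoc (t ^ 3 / (6 * μ ^ 3))]
      gcongr

end

/-! ### Nussbaum–Szkoła distributions -/

section

variable {n : Type*} [Fintype n] [DecidableEq n]

open Matrix

lemma reTrace_cfc_mul_cfc {A B : Matrix n n ℂ} (hA : A.IsHermitian) (hB : B.IsHermitian)
    (f g : ℝ → ℝ) : reTrace (cfc f A * cfc g B) =
      ∑ p : n × n, f (hA.eigenvalues p.1) * g (hB.eigenvalues p.2) * hA.overlap hB p.1 p.2 := by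
  rw [reTrace, hA.cfc_eq_complexCfc, hB.cfc_eq_complexCfc, hA.trace_complexCfc_mul hB,
    Fintype.sum_prod_type, ← Complex.ofReal_re (∑ i, ∑ j, _)]
  push_cast
  rfl

lemma sum_eigenvalues_mul_overlap {A B : Matrix n n ℂ} (hA : A.IsHermitian)
    (hB : B.IsHermitian) :
    ∑ p : n × n, hA.eigenvalues p.1 * hA.overlap hB p.1 p.2 = reTrace A := by
  rw [Fintype.sum_prod_type, reTrace, hA.trace_eq_sum_eigenvalues]
  simp only [← Finset.mul_sum, hA.sum_overlap, mul_one]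
  rw [← Complex.ofReal_re (∑ i, _)]
  push_cast
  rfl

lemma opLog_sub_smul_one {A : Matrix n n ℂ} (hA : A.IsHermitian) (d : ℝ) :
    opLog A - (d : ℂ) • (1 : Matrix n n ℂ) = cfc (fun x => Real.logb 2 x - d) A := by
  rw [opLog, hA.cfc_eq_complexCfc, hA.cfc_eq_complexCfc, ← hA.complexCfc_one, hA.complexCfc_smul,
    hA.complexCfc_sub]
  simp

lemma Matrix.IsHermitian.cfc_mul_cfc {A : Matrix n n ℂ} (hA : A.IsHermitian) (f g : ℝ → ℝ) :
    cfc f A * cfc g A = cfc (fun x => f x * g x) A := by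
  rw [hA.cfc_eq_complexCfc, hA.cfc_eq_complexCfc, hA.cfc_eq_complexCfc, hA.complexCfc_mul]
  simp

lemma Matrix.IsHermitian.cfc_one {A : Matrix n n ℂ} (hA : A.IsHermitian) :
    cfc (fun _ => (1 : ℝ)) A = 1 := by
  rw [hA.cfc_eq_complexCfc]
  simpa using hA.complexCfc_one

lemma Matrix.IsHermitian.cfc_id {A : Matrix n n ℂ} (hA : A.IsHermitian) :
    cfc (fun x : ℝ => x) A = A := by
  rw [hA.cfc_eq_complexCfc, hA.complexCfc_id]

lemma Matrix.IsHermitian.mul_cfc {A : Matrix n n ℂ} (hA : A.IsHermitian) (f : ℝ → ℝ) :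
    A * cfc f A = cfc (fun x => x * f x) A := by
  rw [← hA.cfc_mul_cfc, hA.cfc_id]

lemma Matrix.IsHermitian.cfc_mul {A : Matrix n n ℂ} (hA : A.IsHermitian) (f : ℝ → ℝ) :
    cfc f A * A = cfc (fun x => x * f x) A := by
  simp only [mul_comm _ (f _)]
  rw [← hA.cfc_mul_cfc, hA.cfc_id]

/-- The first moment of the log-likelihood ratio of the Nussbaum–Szkoła distributions. -/
lemma reTrace_mul_opLog_sub {A B : Matrix n n ℂ} (hA : A.IsHermitian) (hB : B.IsHermitian) :
    reTrace (A * (opLog A - opLog B)) =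
      ∑ p : n × n, hA.eigenvalues p.1 * hA.overlap hB p.1 p.2 *
        (Real.logb 2 (hA.eigenvalues p.1) - Real.logb 2 (hB.eigenvalues p.2)) := by
  have h1 : reTrace (A * opLog A) = reTrace (cfc (fun x => x * Real.logb 2 x) A *
      cfc (fun _ => (1 : ℝ)) B) := by
    rw [opLog, hA.mul_cfc, hB.cfc_one, mul_one]
  have h2 : reTrace (A * opLog B) = reTrace (cfc (fun x : ℝ => x) A * cfc (Real.logb 2) B) := by
    rw [opLog, hA.cfc_id]
  have h3 : reTrace (A * (opLog A - opLog B)) = reTrace (A * opLog A) - reTrace (A * opLog B) := by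
    simp only [reTrace, mul_sub, trace_sub, Complex.sub_re]
  rw [h3, h1, h2, reTrace_cfc_mul_cfc hA hB, reTrace_cfc_mul_cfc hA hB,
    ← Finset.sum_sub_distrib]
  exact Finset.sum_congr rfl fun p _ => by ring

/-- The second moment of the log-likelihood ratio of the Nussbaum–Szkoła distributions. -/
lemma reTrace_mul_opLog_sub_sq {A B : Matrix n n ℂ} (hA : A.IsHermitian) (hB : B.IsHermitian)
    (d : ℝ) :
    reTrace (A * (opLog A - opLog B - (d : ℂ) • (1 : Matrix n n ℂ)) ^ 2) =
      ∑ p : n × n, hA.eigenvalues p.1 * hA.overlap hB p.1 p.2 *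
        (Real.logb 2 (hA.eigenvalues p.1) - Real.logb 2 (hB.eigenvalues p.2) - d) ^ 2 := by
  set T := cfc (fun x => Real.logb 2 x - d) A with hT
  set L := cfc (Real.logb 2) B with hL
  -- Absorbing `d` into `T`, a function of `A`, leaves two cross terms; they agree by cyclicity and
  -- `T * A = A * T`, although `A` and `L` need not commute.
  have h1 : trace (A * (opLog A - opLog B - (d : ℂ) • (1 : Matrix n n ℂ)) ^ 2) =
      trace (A * (T * T)) - trace (A * T * L) - trace (T * A * L) + trace (A * (L * L)) := by
    rw [sub_right_comm, opLog_sub_smul_one hA, ← hT, opLog, ← hL,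
      Matrix.mul_assoc T, trace_mul_comm T, Matrix.mul_assoc A L T, ← trace_sub, ← trace_sub,
      ← trace_add]
    congr 1
    noncomm_ring
  have e1 : reTrace (A * (T * T)) = reTrace (cfc (fun x => x * ((Real.logb 2 x - d) *
      (Real.logb 2 x - d))) A * cfc (fun _ => (1 : ℝ)) B) := by
    rw [hT, hA.cfc_mul_cfc, hA.mul_cfc, hB.cfc_one, mul_one]
  have e2 : reTrace (A * T * L) =
      reTrace (cfc (fun x => x * (Real.logb 2 x - d)) A * cfc (Real.logb 2) B) := by
    rw [hT, hA.mul_cfc]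
  have e3 : T * A = A * T := by
    rw [hT, hA.mul_cfc, hA.cfc_mul]
  have e4 : reTrace (A * (L * L)) = reTrace (cfc (fun x : ℝ => x) A *
      cfc (fun x => Real.logb 2 x * Real.logb 2 x) B) := by
    rw [hL, hB.cfc_mul_cfc, hA.cfc_id]
  have h2 : reTrace (A * (opLog A - opLog B - (d : ℂ) • (1 : Matrix n n ℂ)) ^ 2) =
      reTrace (A * (T * T)) - reTrace (A * T * L) - reTrace (A * T * L) +
        reTrace (A * (L * L)) := by
    rw [reTrace, h1, e3]
    simp [reTrace]
  rw [h2, e1, e2, e4, reTrace_cfc_mul_cfc hA hB, reTrace_cfc_mul_cfc hA hB,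
    reTrace_cfc_mul_cfc hA hB, ← Finset.sum_sub_distrib, ← Finset.sum_sub_distrib,
    ← Finset.sum_add_distrib]
  exact Finset.sum_congr rfl fun p _ => by ring

/-- The Petz trace functional as a moment generating function. -/
lemma reTrace_opPow_mul_opPow {A B : Matrix n n ℂ} (hA : A.PosSemidef) (hB : B.PosSemidef)
    (h : opSupport A ≤ opSupport B) {s : ℝ} (hs : s ≠ 0) :
    reTrace (opPow A s * opPow B (1 - s)) =
      ∑ p : n × n, hA.1.eigenvalues p.1 * hA.1.overlap hB.1 p.1 p.2 *
        Real.exp ((s - 1) *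
          (Real.log (hA.1.eigenvalues p.1) - Real.log (hB.1.eigenvalues p.2))) := by
  rw [opPow, opPow, reTrace_cfc_mul_cfc hA.1 hB.1]
  refine Finset.sum_congr rfl fun p _ => ?_
  rcases (hA.eigenvalues_nonneg p.1).eq_or_lt with h0 | hr
  · rw [← h0, Real.zero_rpow hs]; ring
  rcases (hB.eigenvalues_nonneg p.2).eq_or_lt with h0 | hq
  · rw [overlap_eq_zero_of_opSupport_le hA.1 hB.1 h hr.ne' h0.symm]; ring
  have : hA.1.eigenvalues p.1 * Real.exp ((s - 1) *
      (Real.log (hA.1.eigenvalues p.1) - Real.log (hB.1.eigenvalues p.2))) =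
      hA.1.eigenvalues p.1 ^ s * hB.1.eigenvalues p.2 ^ (1 - s) := by
    nth_rw 1 [← Real.exp_log hr]
    rw [Real.rpow_def_of_pos hr, Real.rpow_def_of_pos hq, ← Real.exp_add, ← Real.exp_add]
    congr 1
    ring
  rw [← this]
  ring

/-! ### The two divergence inequalities -/

theorem sandwichedDiv_le_petzDiv {ρ σ : Matrix n n ℂ} (hρ : ρ.PosSemidef) (hρ0 : ρ ≠ 0)
    (hσ : σ.PosSemidef) {α : ℝ} (hα : 1 < α) : sandwichedDiv α ρ σ ≤ petzDiv α ρ σ := by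
  unfold sandwichedDiv petzDiv
  split_ifs with h
  · rw [EReal.coe_le_coe_iff]
    have hα' : 0 < α - 1 := by linarith
    have hs : -((α - 1) / α) / 2 ≠ 0 := by
      have : 0 < (α - 1) / α := by positivity
      linarith
    refine mul_le_mul_of_nonneg_left ?_ (by positivity)
    -- Monotonicity needs a positive sandwiched trace, since `logb 2 0 = 0`; this is where the
    -- support inclusion enters.
    refine Real.logb_le_logb_of_le (by norm_num) ?_ (reTrace_opPow_sandwich_le hρ hσ hα)
    exact reTrace_opPow_pos (posSemidef_opPow_mul_mul hρ hσ _)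
      (opPow_sandwich_ne_zero hρ hσ hρ0 h hs) α
  · exact le_rfl

theorem petzDiv_le {ρ σ : Matrix n n ℂ} (hρ : ρ.PosSemidef) (hρ1 : ρ.trace = 1)
    (hσ : σ.PosSemidef) {α μ : ℝ} (hα : 1 < α) (hμ : 0 < μ) :
    petzDiv α ρ σ ≤ relEntropy ρ σ
        + (((α - 1) * Real.log 2 / 2 * divVariance ρ σ : ℝ) : EReal)
        + (((α - 1) ^ 2 * remainderK ρ σ α μ : ℝ) : EReal) := by
  by_cases h : opSupport ρ ≤ opSupport σ
  swap
  · rw [relEntropy, if_neg h, EReal.top_add_coe, EReal.top_add_coe]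
    exact le_top
  have htr : reTrace ρ = 1 := by simp [reTrace, hρ1]
  have hl2 : 0 < Real.log 2 := Real.log_pos one_lt_two
  set d := reTrace (ρ * (opLog ρ - opLog σ)) with hd
  have hD : relEntropy ρ σ = (d : EReal) := by
    rw [relEntropy, if_pos h, htr, ← hd]; simp
  set w : n × n → ℝ := fun p => hρ.1.eigenvalues p.1 * hρ.1.overlap hσ.1 p.1 p.2 with hw
  set X : n × n → ℝ := fun p =>
    Real.log (hρ.1.eigenvalues p.1) - Real.log (hσ.1.eigenvalues p.2) with hX
  have hXlogb (p : n × n) : Real.logb 2 (hρ.1.eigenvalues p.1) -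
      Real.logb 2 (hσ.1.eigenvalues p.2) = X p / Real.log 2 := by
    simp only [hX, Real.logb, sub_div]
  have hw0 (p : n × n) : 0 ≤ w p :=
    mul_nonneg (hρ.eigenvalues_nonneg _) (hρ.1.overlap_nonneg hσ.1 _ _)
  have hw1 : ∑ p, w p = 1 := (sum_eigenvalues_mul_overlap hρ.1 hσ.1).trans htr
  have hd' : d * Real.log 2 = ∑ p, w p * X p := by
    rw [hd, reTrace_mul_opLog_sub hρ.1 hσ.1, Finset.sum_mul]
    refine Finset.sum_congr rfl fun p _ => ?_
    rw [hXlogb]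
    change w p * (X p / Real.log 2) * Real.log 2 = w p * X p
    field_simp
  -- `X` is in nats and `d` in bits; `Y` is `X` minus its mean.
  set Y : n × n → ℝ := fun p => X p - d * Real.log 2 with hY
  have hY0 : ∑ p, w p * Y p = 0 := by
    simp only [hY, mul_sub, Finset.sum_sub_distrib, ← Finset.sum_mul, hw1, ← hd']
    ring
  have hV : divVariance ρ σ * Real.log 2 ^ 2 = ∑ p, w p * Y p ^ 2 := by
    rw [divVariance, htr, hD, EReal.toReal_coe, reTrace_mul_opLog_sub_sq hρ.1 hσ.1,
      div_one, one_mul, Finset.sum_mul]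
    refine Finset.sum_congr rfl fun p _ => ?_
    rw [hXlogb]
    change w p * (X p / Real.log 2 - d) ^ 2 * Real.log 2 ^ 2 = w p * (X p - d * Real.log 2) ^ 2
    field_simp
  have hexp (t : ℝ) : ∑ p, w p * Real.exp (t * Y p) =
      Real.exp (-(t * (d * Real.log 2))) * ∑ p, w p * Real.exp (t * X p) := by
    rw [Finset.mul_sum]
    refine Finset.sum_congr rfl fun p _ => ?_
    rw [show t * Y p = -(t * (d * Real.log 2)) + t * X p by simp only [hY]; ring, Real.exp_add]
    ring
  have hQ0 (t : ℝ) : 0 < ∑ p, w p * Real.exp (t * X p) := by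
    obtain ⟨p, -, hp⟩ : ∃ p ∈ Finset.univ, w p ≠ 0 :=
      Finset.exists_ne_zero_of_sum_ne_zero (by rw [hw1]; exact one_ne_zero)
    refine Finset.sum_pos' (fun p _ => mul_nonneg (hw0 p) (Real.exp_pos _).le)
      ⟨p, Finset.mem_univ p, mul_pos (lt_of_le_of_ne (hw0 p) hp.symm) (Real.exp_pos _)⟩
  have hpetz {s : ℝ} (hs : 1 < s) : petzDiv s ρ σ =
      ((1 / (s - 1) * (Real.log (∑ p, w p * Real.exp ((s - 1) * X p)) / Real.log 2) : ℝ) :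
        EReal) := by
    rw [petzDiv, if_pos h, reTrace_opPow_mul_opPow hρ hσ h (by positivity), Real.logb]
  -- Both exponentials in `K` are moment generating functions of `Y`, at `α - 1` and `α + μ - 1`.
  have htwo {s : ℝ} (hs : 1 < s) : (2 : ℝ) ^ ((s - 1) *
      ((petzDiv s ρ σ).toReal - (relEntropy ρ σ).toReal)) =
      ∑ p, w p * Real.exp ((s - 1) * Y p) := by
    have hs' : s - 1 ≠ 0 := by linarith
    rw [hpetz hs, hD, EReal.toReal_coe, EReal.toReal_coe, hexp, Real.rpow_def_of_pos two_pos]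
    nth_rw 2 [← Real.exp_log (hQ0 (s - 1))]
    rw [← Real.exp_add]
    congr 1
    field_simp
    ring
  have key := log_sum_mul_exp_le hw0 hw1 hY0 (t := α - 1) (by linarith) hμ
  have hlog : Real.log (∑ p, w p * Real.exp ((α - 1) * Y p)) =
      Real.log (∑ p, w p * Real.exp ((α - 1) * X p)) - (α - 1) * (d * Real.log 2) := by
    rw [hexp, Real.log_mul (Real.exp_pos _).ne' (hQ0 _).ne', Real.log_exp]
    ring
  have hK : remainderK ρ σ α μ * Real.log 2 = 1 / (6 * μ ^ 3) *
      (∑ p, w p * Real.exp ((α - 1) * Y p)) *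
        Real.log (∑ p, w p * Real.exp ((α - 1 + μ) * Y p) + Real.exp 2) ^ 3 := by
    rw [remainderK, htwo hα, htwo (by linarith : 1 < α + μ),
      show α + μ - 1 = α - 1 + μ by ring]
    field_simp
  rw [hlog, ← hV] at key
  rw [hpetz hα, hD, ← EReal.coe_add, ← EReal.coe_add, EReal.coe_le_coe_iff]
  have hα' : 0 < α - 1 := by linarith
  -- The claim is `key` divided by `(α - 1) ln 2`.
  rw [one_div_mul_eq_div, div_le_iff₀ hα', div_le_iff₀ hl2]
  have e : (α - 1) ^ 3 / (6 * μ ^ 3) * (∑ p, w p * Real.exp ((α - 1) * Y p)) *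
      Real.log (∑ p, w p * Real.exp ((α - 1 + μ) * Y p) + Real.exp 2) ^ 3 =
      (α - 1) ^ 3 * (remainderK ρ σ α μ * Real.log 2) := by
    rw [hK]; ring
  rw [e] at key
  linarith

end

/-- If the support of `ρ` is not contained in that of `σ`, then `D(ρ‖σ) = ⊤`, both Rényi
divergences are `⊤`, and the right-hand side is `⊤` whatever the (then meaningless) real numbers
`V` and `K` are. -/
theorem mainTheorem3 {n : Type*} [Fintype n] [DecidableEq n] (ρ σ : Matrix n n ℂ)
    (hρ : ρ.PosSemidef) (hρ1 : ρ.trace = 1) (hσ : σ.PosSemidef)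
    (α μ : ℝ) (hα : 1 < α) (hμ0 : 0 < μ) (hμ1 : μ < 1) :
    sandwichedDiv α ρ σ ≤ petzDiv α ρ σ ∧
      petzDiv α ρ σ ≤ relEntropy ρ σ
        + (((α - 1) * Real.log 2 / 2 * divVariance ρ σ : ℝ) : EReal)
        + (((α - 1) ^ 2 * remainderK ρ σ α μ : ℝ) : EReal) := by
  refine ⟨sandwichedDiv_le_petzDiv hρ ?_ hσ hα, petzDiv_le hρ hρ1 hσ hα hμ0⟩
  rintro rfl
  simp at hρ1
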